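/- **Setting.** Let $\mathcal X$ be a set with pseudometrics $d_1,\dots,d_k$. For a pseudometric $d$ put $d(U,S)=\inf_{x\in U,\,y\in S}d(x,y)$ (with value $\infty$ if $U$ or $S$ is empty) and $\phi_d(S)=\sup_{x,y\in S}d(x,y)$ (with $\phi_d(\emptyset)=0$). A clustering $\mathcal C=(C_1,\dots,C_k)$ of a finite set $X\subseteq\mathcal X$ is a $k$-tuple of pairwise disjoint, possibly empty sets with union $X$. It has *one-versus-all margin* $\gamma$ with respect to $d_1,\dots,d_k$ if $d_i(X\setminus C_i,C_i)>\gamma\,\phi_{d_i}(C_i)$ for all $i$. For $\gamma>0$ let $M(\gamma,d)$ be the supremum, over $x\in\mathcal X$ and $r>0$, of the cardinalities of sets $A\subseteq\{y : d(x,y)\le r\}$ with $d(y,y')>\gamma r$ for all distinct $y,y'\in A$, and let $M(\gamma)=\max_i M(\gamma,d_i)$. The pseudometrics, $\gamma$ and $X$ are known to the algorithm. The clustering $\mathcal C$ is unknown and is accessed through adaptive label queries: a query of $x\in X$ returns the index $i$ with $x\in C_i$. **MRECOVER** with constant $a>0$: set $Y=X$, $M=\max(2,M(\gamma))$, $m=\lceil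 a\,M k\log k\rceil$. While $Y\neq\emptyset$: draw a sample $S$ of $m$ independent uniform points of $Y$ and query their labels (this counts as $m$ queries); for each $i$ let $S_i$ be the set of sampled points with label $i$, and let $\hat C_i$ be the intersection of all $C\subseteq Y$ with $d_i(Y\setminus C,C)>\gamma\,\phi_{d_i}(C)$ whose sampled points are exactly those of $S_i$; give label $i$ to every point of $\hat C_i$; replace $Y$ by $Y\setminus\bigcup_i\hat C_i$. When $Y=\emptyset$, return for each $i$ the set of points with label $i$. **Theorem.** 1. *Upper bound.* There is an absolute constant $a_0>0$ such that for every $a\ge a_0$ the following holds for all $\mathcal X$, $k\ge 2$, $d_1,\dots,d_k$ and $\gamma>0$ with $M(\gamma)<\infty$, and every finite $X\subseteq\mathcal X$ with $n=|X|$ whose latent clustering $\mathcal C$ has one-versus-all margin $\gamma$. MRECOVER with constant $a$ never returns anything other than $\mathcal C$, and it terminates almost surely. Moreover, for every $s>0$ there is a constant $B$ depending only on $s$ and $a$ such that, if $n\ge 2$, then with probability at least $1-n^{-s}$ it makes at most $B\,M k\log k\,\log n$ queries, where $M=\max(2,M(\gamma))$. 2. *Lower bound.* For every $p>\tfrac12$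 there is a constant $b>0$ depending only on $p$ such that the following holds for all $\mathcal X,k,d_1,\dots,d_k$ and $\gamma>0$ satisfying this nondegeneracy condition: for some $i\ne j$ there are a ball of radius $r>0$ for $d_j$ and a set $P$ of exactly $M(2\gamma)<\infty$ points in it with $d_j(x,y)>2\gamma r$ and $d_i(x,y)>0$ for all distinct $x,y\in P$. (If $k\ge2$, $\mathcal X\neq\emptyset$ and $M(2\gamma)<\infty$, this holds automatically when all $d_i$ are metrics, and also when $d_1=\dots=d_k$.) For every randomized adaptive query algorithm $\mathcal A$ that returns $\mathcal C$ with probability at least $p$ on every instance with one-versus-all margin $\gamma$ with respect to $d_1,\dots,d_k$, there is such an instance on which $\mathcal A$ makes at least $b\,M(2\gamma)$ queries in expectation. In particular ($p=1$), this applies to every algorithm that always returns $\mathcal C$. -/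

import Mathlib

open MeasureTheory
open scoped ENNReal NNReal

noncomputable section

namespace ClusterRecovery

/-! ### Pseudometrics: distance of sets, packing numbers -/

/-- `d(U, S)`, the infimum of `d(x, y)` over `x ∈ U` and `y ∈ S`. It is `∞` if `U` or `S` is
empty. -/
def setDist {𝒳 : Type*} (d : PseudoMetricSpace 𝒳) (U S : Set 𝒳) : ℝ≥0∞ :=
  letI := d
  ⨅ x ∈ U, ⨅ y ∈ S, edist x y

/-- The diameter `φ_d(S)`, the supremum of `d(x, y)` over `x, y ∈ S`. It is `0` if `S` is empty. -/
def diameter {𝒳 : Type*} (d : PseudoMetricSpace 𝒳) (S : Set 𝒳) : ℝ≥0∞ :=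
  letI := d
  ⨆ x ∈ S, ⨆ y ∈ S, edist x y

/-- `M(γ, d)`: the largest number of points at pairwise distance greater than `γ r` in a closed ball
of radius `r`, over all centres and all radii `r > 0`. -/
def ballPacking {𝒳 : Type*} (d : PseudoMetricSpace 𝒳) (γ : ℝ) : ℕ∞ :=
  letI := d
  ⨆ (x : 𝒳) (r : ℝ) (_ : 0 < r),
    Metric.packingNumber (Real.toNNReal (γ * r)) (Metric.closedBall x r)

/-- `M(γ)`, the maximum of `M(γ, d i)` over the given pseudometrics. -/
def maxPacking {𝒳 : Type*} {k : ℕ} (d : Fin k → PseudoMetricSpace 𝒳) (γ : ℝ) : ℕ∞ :=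
  ⨆ i, ballPacking (d i) γ

/-! ### Clusterings and margin -/

/-- A clustering `(C_1, …, C_k)` of the finite set `X` (pairwise disjoint, possibly empty sets with
union `X`) is given by its labelling `X → Fin k`; this is its `i`-th cluster. -/
def cluster {𝒳 : Type*} {k : ℕ} {X : Finset 𝒳} (c : X → Fin k) (i : Fin k) : Finset 𝒳 :=
  (Finset.univ.filter fun x => c x = i).map (Function.Embedding.subtype _)

/-- `d(X \ C, C) > γ φ_d(C)`. -/
def SetHasMargin {𝒳 : Type*} (d : PseudoMetricSpace 𝒳) (γ : ℝ) (X C : Finset 𝒳) : Prop :=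
  ENNReal.ofReal γ * diameter d (C : Set 𝒳) < setDist d ((X : Set 𝒳) \ C) C

/-- One-versus-all margin `γ` with respect to `d_1, …, d_k`. -/
def HasMargin {𝒳 : Type*} {k : ℕ} (d : Fin k → PseudoMetricSpace 𝒳) (γ : ℝ) {X : Finset 𝒳}
    (c : X → Fin k) : Prop :=
  ∀ i, SetHasMargin (d i) γ X (cluster c i)

/-! ### Adaptive query algorithms with access to a label oracle -/

/-- A deterministic adaptive algorithm on the point set `X`: from the points queried so far and the
labels received (oldest first), it chooses a point of `X` to query next, or it stops and returns a
`k`-tuple of sets. A randomized algorithm is a strategy that depends on a random seed. -/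
abbrev Strategy {𝒳 : Type*} (X : Finset 𝒳) (k : ℕ) : Type _ :=
  List (X × Fin k) → X ⊕ (Fin k → Finset 𝒳)

/-- The queries and answers in the first `t` steps of `σ` against the oracle `c`. -/
def transcript {𝒳 : Type*} {X : Finset 𝒳} {k : ℕ} (σ : Strategy X k) (c : X → Fin k) :
    ℕ → List (X × Fin k)
  | 0 => []
  | t + 1 =>
    match σ (transcript σ c t) with
    | Sum.inl x => transcript σ c t ++ [(x, c x)]
    | Sum.inr _ => transcript σ c t

/-- `σ` stops after finitely many queries to the oracle `c` and returns `G`. -/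
def Outputs {𝒳 : Type*} {X : Finset 𝒳} {k : ℕ} (σ : Strategy X k) (c : X → Fin k)
    (G : Fin k → Finset 𝒳) : Prop :=
  ∃ t, σ (transcript σ c t) = Sum.inr G

/-- The number of queries that `σ` makes to the oracle `c`; it is `∞` if `σ` never stops. -/
def numQueries {𝒳 : Type*} {X : Finset 𝒳} {k : ℕ} (σ : Strategy X k) (c : X → Fin k) : ℕ∞ :=
  ⨅ (t : ℕ) (_ : (σ (transcript σ c t)).isRight = true), (t : ℕ∞)

/-! ### The algorithm MRECOVER -/

/-- The random source: for every time `j` and every nonempty finite set `Y`, a point of `Y`. -/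
abbrev Draws (𝒳 : Type*) : Type _ :=
  (p : ℕ × {Y : Finset 𝒳 // Y.Nonempty}) → p.2.1

instance drawsMeasurableSpace (𝒳 : Type*) : MeasurableSpace (Draws 𝒳) :=
  @MeasurableSpace.pi _ _ fun _ => ⊤

instance nonemptyOfDraw {𝒳 : Type*} (Y : {Y : Finset 𝒳 // Y.Nonempty}) : Nonempty Y.1 :=
  Y.2.to_subtype

/-- The uniform distribution on a nonempty finite set. -/
def uniformDraw {𝒳 : Type*} (Y : {Y : Finset 𝒳 // Y.Nonempty}) : @Measure Y.1 ⊤ :=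
  @PMF.toMeasure Y.1 ⊤ (PMF.uniformOfFintype Y.1)

/-- All the draws are independent, and each is uniform on its set. -/
def drawLaw (𝒳 : Type*) : Measure (Draws 𝒳) :=
  @Measure.infinitePi (ℕ × {Y : Finset 𝒳 // Y.Nonempty}) (fun p => p.2.1) (fun _ => ⊤)
    (fun p => uniformDraw p.2)

instance drawLaw_isProbabilityMeasure (𝒳 : Type*) : IsProbabilityMeasure (drawLaw 𝒳) := by
  let : ∀ p : ℕ × {Y : Finset 𝒳 // Y.Nonempty}, MeasurableSpace p.2.1 := fun _ => ⊤
  have : ∀ p : ℕ × {Y : Finset 𝒳 // Y.Nonempty}, IsProbabilityMeasure (uniformDraw p.2) :=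
    fun p => PMF.toMeasure.isProbabilityMeasure _
  exact inferInstanceAs (IsProbabilityMeasure
    (Measure.infinitePi fun p : ℕ × {Y : Finset 𝒳 // Y.Nonempty} => uniformDraw p.2))

open Classical in
/-- The points of a labelled sample. -/
def samplePoints {𝒳 : Type*} {X : Finset 𝒳} {k : ℕ} (S : List (X × Fin k)) : Finset 𝒳 :=
  (S.map fun q => q.1.1).toFinset

/-- The points of a labelled sample that have label `i`. -/
def sampleLabelled {𝒳 : Type*} {X : Finset 𝒳} {k : ℕ} (S : List (X × Fin k)) (i : Fin k) :
    Finset 𝒳 :=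
  samplePoints (S.filter fun q => q.2 = i)

open Classical in
/-- The smallest set consistent with the points of label `i` in the sample `S`, in the class `H_i` of
all `C ⊆ Y` that have margin `γ` in `Y` with respect to `d`: the intersection of all `C ∈ H_i` whose
points in the sample are exactly those of label `i`. -/
def smallestConsistent {𝒳 : Type*} {X : Finset 𝒳} {k : ℕ} (d : PseudoMetricSpace 𝒳) (γ : ℝ)
    (Y : Finset 𝒳) (S : List (X × Fin k)) (i : Fin k) : Finset 𝒳 :=
  Y.filter fun x => ∀ C : Finset 𝒳, C ⊆ Y → SetHasMargin d γ Y C →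
    C ∩ samplePoints S = sampleLabelled S i → x ∈ C

open Classical in
/-- The points of `X` that have not been labelled yet; `G i` are those with label `i` so far. -/
def remaining {𝒳 : Type*} {k : ℕ} (X : Finset 𝒳) (G : Fin k → Finset 𝒳) : Finset 𝒳 :=
  X \ Finset.univ.biUnion G

theorem remaining_subset {𝒳 : Type*} {k : ℕ} (X : Finset 𝒳) (G : Fin k → Finset 𝒳) :
    remaining X G ⊆ X := by
  classical
  exact Finset.sdiff_subset

open Classical in
/-- The sets labelled in the first `t` rounds with samples of size `m`: the sample of round `t`
consists of the entries `t m, …, (t + 1) m - 1` of the list of queries and answers, and label `i` is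
given to the smallest consistent set for `i` in what remained before the round. -/
def labelledAfter {𝒳 : Type*} {X : Finset 𝒳} {k : ℕ} (d : Fin k → PseudoMetricSpace 𝒳) (γ : ℝ)
    (m : ℕ) (hist : List (X × Fin k)) : ℕ → Fin k → Finset 𝒳
  | 0 => fun _ => ∅
  | t + 1 => fun i =>
    labelledAfter d γ m hist t i ∪
      smallestConsistent (d i) γ (remaining X (labelledAfter d γ m hist t))
        ((hist.drop (t * m)).take m) i

/-- `M = max(2, M(γ))`, used where `M(γ)` is finite. -/
def packingParam {𝒳 : Type*} {k : ℕ} (d : Fin k → PseudoMetricSpace 𝒳) (γ : ℝ) : ℕ :=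
  max 2 (maxPacking d γ).toNat

/-- The sample size `⌈a M k log k⌉` of a round of MRECOVER, for a constant `a`. -/
def sampleSize {𝒳 : Type*} {k : ℕ} (a : ℝ) (d : Fin k → PseudoMetricSpace 𝒳) (γ : ℝ) : ℕ :=
  ⌈a * packingParam d γ * k * Real.log k⌉₊

open Classical in
/-- MRECOVER with sample-size constant `a` and random source `ω`. As long as unlabelled points
remain, a round queries a sample of `sampleSize a d γ` points drawn uniformly and independently (with
repetition) from the unlabelled points, and then labels, for each `i`, the smallest set consistent
with the sampled points of label `i`. It stops and returns the labelled sets when no point is left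
at the beginning of a round. -/
def mrecover {𝒳 : Type*} {k : ℕ} (a : ℝ) (d : Fin k → PseudoMetricSpace 𝒳) (γ : ℝ) (X : Finset 𝒳)
    (ω : Draws 𝒳) : Strategy X k := fun hist =>
  let m := sampleSize a d γ
  let G := labelledAfter d γ m hist (hist.length / m)
  if h : (remaining X G).Nonempty then
    Sum.inl ⟨(ω (hist.length, ⟨remaining X G, h⟩)).1,
      remaining_subset X G (ω (hist.length, ⟨remaining X G, h⟩)).2⟩
  else Sum.inr G

end ClusterRecovery

end

universe u v

open ClusterRecovery

/-! Upper bound. A set with margin keeps every outside point farther from it than `γ` times its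
diameter. If each of several points is excluded by such a set containing all the others, then, after
one endpoint of a farthest pair is dropped, the rest are `γD`-separated in a ball of radius `D`, the
largest distance. So there are at most `M(γ) + 1` of them (`card_le_ballPacking_add_one`). Among `m
+ 1` independent uniform points of the pool, a position of label `i` that the other `m` points fail
to recover is excluded by a consistent set containing all other points of label `i`. Hence at most
`k (M(γ) + 1)` positions are missed (`card_leaveOneOut_le`), and by symmetry a round leaves on
average at most a fraction `k (M(γ) + 1) / (m + 1)` of the pool (`sum_card_unlabelled_le`). This is
at most `exp (-1)` once `a ≥ 10`. Independence of the rounds' draws gives geometric decay of the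
expected pool size, and Markov's inequality finishes. No label is ever wrong, since the true cluster
restricted to the pool is itself a consistent candidate (`smallestConsistent_subset_cluster`). Lower
bound. On a maximal packing `P`, the labelling constantly `j` and each labelling that moves one
point to `i` all have margin. An algorithm correct on both with the same seed must query the moved
point in the constant run. This has probability at least `2p - 1` for each point of `P`, and the
expectations add up (`le_lintegral_numQueries`). -/

namespace ClusterRecovery

/-! ### Margins and packings -/

section Margin

variable {𝒳 : Type*} {d : PseudoMetricSpace 𝒳} {γ : ℝ}

theorem SetHasMargin.mul_dist_lt (hγ : 0 ≤ γ) {Y C : Finset 𝒳} (h : SetHasMargin d γ Y C)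
    {x y z u : 𝒳} (hx : x ∈ C) (hy : y ∈ C) (hzY : z ∈ Y) (hzC : z ∉ C) (hu : u ∈ C) :
    γ * d.dist x y < d.dist z u := by
  let := d
  have h1 : edist x y ≤ diameter d (C : Set 𝒳) :=
    le_iSup₂_of_le x hx (le_iSup₂_of_le y hy le_rfl)
  have h2 : setDist d ((Y : Set 𝒳) \ C) C ≤ edist z u :=
    iInf₂_le_of_le z ⟨hzY, hzC⟩ (iInf₂_le_of_le u hu le_rfl)
  have h3 : ENNReal.ofReal γ * edist x y < edist z u :=
    (mul_le_mul_right h1 _).trans_lt (lt_of_lt_of_le h h2)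
  rw [edist_dist, edist_dist, ← ENNReal.ofReal_mul hγ] at h3
  exact (ENNReal.ofReal_lt_ofReal_iff_of_nonneg (mul_nonneg hγ dist_nonneg)).1 h3

/-- Diameters shrink and distances grow under restriction. This lets the latent clusters keep their
margin inside the shrinking pool. -/
theorem SetHasMargin.mono {X Y C D : Finset 𝒳} (h : SetHasMargin d γ X C) (hDC : D ⊆ C)
    (hYD : ∀ x ∈ Y, x ∉ D → x ∈ X ∧ x ∉ C) : SetHasMargin d γ Y D := by
  let := d
  have h1 : diameter d (D : Set 𝒳) ≤ diameter d (C : Set 𝒳) :=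
    iSup₂_le fun x hx => iSup₂_le fun y hy =>
      le_iSup₂_of_le x (hDC hx) (le_iSup₂_of_le y (hDC hy) le_rfl)
  have h2 : setDist d ((X : Set 𝒳) \ C) C ≤ setDist d ((Y : Set 𝒳) \ D) D :=
    le_iInf₂ fun x hx => le_iInf₂ fun y hy =>
      iInf₂_le_of_le x (hYD x hx.1 hx.2) (iInf₂_le_of_le y (hDC hy) le_rfl)
  exact (mul_le_mul_right h1 _).trans_lt (lt_of_lt_of_le h h2)

theorem setHasMargin_of_dist_le (hγ : 0 ≤ γ) {X C : Finset 𝒳} {D : ℝ} (hD : 0 ≤ D)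
    -- Finiteness matters in what follows: strict bounds on the individual distances give a strict
    -- bound on their infimum, because a minimum `δ` is attained.
    (hC : ∀ x ∈ C, ∀ y ∈ C, d.dist x y ≤ D)
    (hX : ∀ z ∈ X, z ∉ C → ∀ u ∈ C, γ * D < d.dist z u) : SetHasMargin d γ X C := by
  classical
  let := d
  obtain ⟨δ, hδ, hle⟩ : ∃ δ, γ * D < δ ∧ ∀ z ∈ X, z ∉ C → ∀ u ∈ C, δ ≤ dist z u := by
    rcases ((X \ C) ×ˢ C).eq_empty_or_nonempty with h | h
    · refine ⟨γ * D + 1, by linarith, fun z hz hzC u hu => ?_⟩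
      have : (z, u) ∈ (X \ C) ×ˢ C := by simp [hz, hzC, hu]
      simp [h] at this
    · obtain ⟨p, hp, hmin⟩ := Finset.exists_min_image _ (fun q : 𝒳 × 𝒳 => dist q.1 q.2) h
      simp only [Finset.mem_product, Finset.mem_sdiff] at hp
      exact ⟨_, hX p.1 hp.1.1 hp.1.2 p.2 hp.2, fun z hz hzC u hu =>
        hmin (z, u) (by simp [hz, hzC, hu])⟩
  have h1 : diameter d (C : Set 𝒳) ≤ ENNReal.ofReal D :=
    iSup₂_le fun x hx => iSup₂_le fun y hy => by
      rw [edist_dist]; exact ENNReal.ofReal_le_ofReal (hC x hx y hy)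
  have h2 : ENNReal.ofReal δ ≤ setDist d ((X : Set 𝒳) \ C) C :=
    le_iInf₂ fun x hx => le_iInf₂ fun y hy => by
      rw [edist_dist]; exact ENNReal.ofReal_le_ofReal (hle x hx.1 hx.2 y hy)
  refine (mul_le_mul_right h1 _).trans_lt (lt_of_lt_of_le ?_ h2)
  rw [← ENNReal.ofReal_mul hγ]
  exact (ENNReal.ofReal_lt_ofReal_iff_of_nonneg (by positivity)).2 hδ

/-- A family of points each of which is separated from all the others by a set with margin has at
most `M(γ, d) + 1` members. -/
theorem card_le_ballPacking_add_one (hγ : 0 < γ) {ι : Type*} [DecidableEq ι] (J : Finset ι)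
    (w : ι → 𝒳) (Y : Finset 𝒳) (C : ι → Finset 𝒳) (hC : ∀ j ∈ J, SetHasMargin d γ Y (C j))
    (hY : ∀ j ∈ J, w j ∈ Y) (hself : ∀ j ∈ J, w j ∉ C j)
    (hother : ∀ j ∈ J, ∀ l ∈ J, l ≠ j → w l ∈ C j) :
    (J.card : ℕ∞) ≤ ballPacking d γ + 1 := by
  classical
  let := d
  rcases Nat.lt_or_ge 1 J.card with hcard | hcard
  swap
  · exact le_add_left (by exact_mod_cast hcard)
  have key : ∀ j ∈ J, ∀ l ∈ J, ∀ l' ∈ J, ∀ l'' ∈ J, l ≠ j → l' ≠ j → l'' ≠ j →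
      γ * dist (w l) (w l') < dist (w j) (w l'') := fun j hj l hl l' hl' l'' hl'' h h' h'' =>
    (hC j hj).mul_dist_lt hγ.le (hother j hj l hl h) (hother j hj l' hl' h') (hY j hj)
      (hself j hj) (hother j hj l'' hl'' h'')
  obtain ⟨p, q, hp, hq, hpq⟩ := Finset.one_lt_card_iff.1 hcard
  -- The farthest pair gives the radius. Any `C j` with `j ≠ a, b` contains `w a` and `w b`, so its
  -- diameter is at least that radius.
  obtain ⟨⟨a, b⟩, hab, hmax⟩ := Finset.exists_max_image (J ×ˢ J)
    (fun t : ι × ι => dist (w t.1) (w t.2)) ⟨(p, q), by simp [hp, hq]⟩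
  simp only [Finset.mem_product] at hab hmax
  have hD : 0 < dist (w a) (w b) := by
    have := key p hp q hq q hq q hq hpq.symm hpq.symm hpq.symm
    simp only [dist_self, mul_zero] at this
    exact this.trans_le (hmax (p, q) ⟨hp, hq⟩)
  have hsep : ∀ j ∈ J.erase a, ∀ l ∈ J.erase a, j ≠ l →
      γ * dist (w a) (w b) < dist (w j) (w l) := by
    intro j hj l hl hjl
    rw [Finset.mem_erase] at hj hl
    -- At most one of `j`, `l` is `b`, and neither is `a`. The set used is the one omitting a point
    -- other than `w b`.
    by_cases hjb : j = b
    · rw [dist_comm (w j)]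
      exact key l hl.2 a hab.1 b hab.2 j hj.2 hl.1.symm (by rw [← hjb]; exact hjl) hjl
    · exact key j hj.2 a hab.1 b hab.2 l hl.2 hj.1.symm (Ne.symm hjb) hjl.symm
  have hinj : Set.InjOn w (J.erase a) := by
    intro j hj l hl h
    by_contra hjl
    have := hsep j hj l hl hjl
    rw [h, dist_self] at this
    nlinarith
  have h1 : ((w '' (J.erase a : Finset ι) : Set 𝒳)).encard ≤ ballPacking d γ := by
    refine le_iSup_of_le (w b) (le_iSup_of_le (dist (w a) (w b)) (le_iSup_of_le hD ?_))
    refine Metric.IsSeparated.encard_le_packingNumber ?_ ?_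
    · rintro _ ⟨j, hj, rfl⟩
      rw [Finset.mem_coe, Finset.mem_erase] at hj
      exact hmax (j, b) ⟨hj.2, hab.2⟩
    · rintro _ ⟨j, hj, rfl⟩ _ ⟨l, hl, rfl⟩ hne
      have := hsep j hj l hl (fun h => hne (by rw [h]))
      change (ENNReal.ofReal _) < _
      rw [edist_dist]
      exact (ENNReal.ofReal_lt_ofReal_iff_of_nonneg (by positivity)).2 this
  rw [hinj.encard_image, Set.encard_coe_eq_coe_finsetCard] at h1
  rw [← Finset.card_erase_add_one hab.1]
  push_cast
  gcongr

end Margin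

/-! ### Runs of a strategy -/

section Runs

variable {𝒳 : Type*} {X : Finset 𝒳} {k : ℕ} {σ : Strategy X k} {c : X → Fin k}

theorem transcript_succ_of_inl {t : ℕ} {x : X} (h : σ (transcript σ c t) = Sum.inl x) :
    transcript σ c (t + 1) = transcript σ c t ++ [(x, c x)] := by
  simp [transcript, h]

theorem transcript_succ_of_inr {t : ℕ} {G : Fin k → Finset 𝒳}
    (h : σ (transcript σ c t) = Sum.inr G) : transcript σ c (t + 1) = transcript σ c t := by
  simp [transcript, h]

theorem transcript_length_le (σ : Strategy X k) (c : X → Fin k) (t : ℕ) :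
    (transcript σ c t).length ≤ t := by
  induction t with
  | zero => simp [transcript]
  | succ t ih =>
    rcases h : σ (transcript σ c t) with x | G
    · rw [transcript_succ_of_inl h]; simpa using ih
    · rw [transcript_succ_of_inr h]; omega

theorem transcript_prefix_of_le {s t : ℕ} (hst : s ≤ t) :
    transcript σ c s <+: transcript σ c t := by
  induction t, hst using Nat.le_induction with
  | base => exact List.prefix_rfl
  | succ t _ ih =>
    refine ih.trans ?_
    rcases h : σ (transcript σ c t) with x | G
    · rw [transcript_succ_of_inl h]; exact List.prefix_append _ _
    · rw [transcript_succ_of_inr h]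

theorem transcript_eq_of_stopped {s t : ℕ} (hst : s ≤ t) {G : Fin k → Finset 𝒳}
    (h : σ (transcript σ c s) = Sum.inr G) : transcript σ c t = transcript σ c s := by
  induction t, hst using Nat.le_induction with
  | base => rfl
  | succ t _ ih => rw [← ih] at h; rw [transcript_succ_of_inr h, ih]

theorem Outputs.unique {G G' : Fin k → Finset 𝒳} (h : Outputs σ c G) (h' : Outputs σ c G') :
    G = G' := by
  obtain ⟨s, hs⟩ := h
  obtain ⟨t, ht⟩ := h'
  rcases le_total s t with hst | hst
  · rw [transcript_eq_of_stopped hst hs, hs] at ht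
    exact Sum.inr.inj ht
  · rw [transcript_eq_of_stopped hst ht, ht] at hs
    exact (Sum.inr.inj hs).symm

theorem transcript_length_of_not_stopped {t : ℕ} (h : (σ (transcript σ c t)).isRight = false) :
    (transcript σ c t).length = t := by
  induction t with
  | zero => rfl
  | succ t ih =>
    rcases h' : σ (transcript σ c t) with x | G
    · rw [transcript_succ_of_inl h', List.length_append, List.length_singleton, ih (by simp [h'])]
    · rw [transcript_succ_of_inr h', h'] at h
      simp at h

theorem numQueries_le_of_stopped {t : ℕ} {G : Fin k → Finset 𝒳}
    (h : σ (transcript σ c t) = Sum.inr G) : numQueries σ c ≤ t :=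
  iInf₂_le t (by simp [h])

/-- The point `x` is queried in the run of `σ` against `c`. -/
def Queried (σ : Strategy X k) (c : X → Fin k) (x : X) : Prop :=
  ∃ t, (x, c x) ∈ transcript σ c t

open Classical in
theorem card_queried_le_numQueries (σ : Strategy X k) (c : X → Fin k) :
    ((Finset.univ.filter (Queried σ c)).card : ℕ∞) ≤ numQueries σ c := by
  refine le_iInf₂ fun t ht => ?_
  obtain ⟨G, hG⟩ := Sum.isRight_iff.1 ht
  have hsub : Finset.univ.filter (Queried σ c) ⊆ ((transcript σ c t).map Prod.fst).toFinset := by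
    intro x hx
    obtain ⟨s, hs⟩ := (Finset.mem_filter.1 hx).2
    rw [List.mem_toFinset, List.mem_map]
    refine ⟨(x, c x), ?_, rfl⟩
    rcases le_total s t with hst | hst
    · exact (transcript_prefix_of_le hst).subset hs
    · rwa [transcript_eq_of_stopped hst hG] at hs
  have h := (Finset.card_le_card hsub).trans (List.toFinset_card_le _)
  rw [List.length_map] at h
  exact_mod_cast h.trans (transcript_length_le σ c t)

/-- Two oracles that differ only at an unqueried point give the same answers, so the runs never
diverge. -/
theorem transcript_congr {c' : X → Fin k} {x : X} (hcc : ∀ y, y ≠ x → c y = c' y)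
    (hx : ¬ Queried σ c x) (t : ℕ) : transcript σ c' t = transcript σ c t := by
  induction t with
  | zero => rfl
  | succ t ih =>
    rcases h : σ (transcript σ c t) with y | G
    · have hyx : y ≠ x := by
        rintro rfl
        exact hx ⟨t + 1, by rw [transcript_succ_of_inl h]; simp⟩
      rw [transcript_succ_of_inl h, transcript_succ_of_inl (ih ▸ h), ih, hcc y hyx]
    · rw [transcript_succ_of_inr h, transcript_succ_of_inr (ih ▸ h), ih]

theorem Outputs.congr {c' : X → Fin k} {x : X} (hcc : ∀ y, y ≠ x → c y = c' y)
    (hx : ¬ Queried σ c x) {G : Fin k → Finset 𝒳} (h : Outputs σ c' G) : Outputs σ c G := by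
  obtain ⟨t, ht⟩ := h
  exact ⟨t, by rwa [transcript_congr hcc hx] at ht⟩

/-- Transcripts range over a countable set. Only histories shorter than `t` matter; with the
σ-algebra of the draws before time `t`, this shows that a run of MRECOVER up to time `t` depends on
the past alone. -/
theorem measurableSet_transcript_eq {Ω : Type*} [MeasurableSpace Ω] {A : Ω → Strategy X k}
    (c : X → Fin k) (t : ℕ)
    (hA : ∀ hist : List (X × Fin k), hist.length < t → ∀ out, MeasurableSet {ω | A ω hist = out})
    (l : List (X × Fin k)) : MeasurableSet {ω | transcript (A ω) c t = l} := by
  induction t generalizing l with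
  | zero => simp only [transcript, MeasurableSet.const]
  | succ t ih =>
    have heq : {ω | transcript (A ω) c (t + 1) = l} =
        ⋃ l₀ : List (X × Fin k), {ω | transcript (A ω) c t = l₀} ∩
          ((⋃ x : X, {ω | A ω l₀ = Sum.inl x} ∩ {_ω | l₀ ++ [(x, c x)] = l}) ∪
            ((⋃ x : X, {ω | A ω l₀ = Sum.inl x})ᶜ ∩ {_ω | l₀ = l})) := by
      ext ω
      simp only [Set.mem_ofPred_eq, Set.mem_iUnion, Set.mem_inter_iff, Set.mem_union,
        Set.mem_compl_iff]
      constructor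
      · intro h
        refine ⟨_, rfl, ?_⟩
        rcases h' : A ω (transcript (A ω) c t) with x | G
        · rw [transcript_succ_of_inl h'] at h
          exact Or.inl ⟨x, rfl, h⟩
        · rw [transcript_succ_of_inr h'] at h
          exact Or.inr ⟨by simp, h⟩
      · rintro ⟨l₀, rfl, ⟨x, hx, h⟩ | ⟨hx, h⟩⟩
        · rw [transcript_succ_of_inl hx, h]
        · rcases h' : A ω (transcript (A ω) c t) with x | G
          · exact absurd ⟨x, h'⟩ hx
          · rw [transcript_succ_of_inr h', h]
    rw [heq]
    refine MeasurableSet.iUnion fun l₀ => ?_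
    by_cases hl₀ : l₀.length < t + 1
    · refine (ih (fun hist hh => hA hist (by omega)) l₀).inter
        (MeasurableSet.union (MeasurableSet.iUnion fun x => ?_) ?_)
      · exact (hA l₀ hl₀ _).inter (MeasurableSet.const _)
      · exact (MeasurableSet.iUnion fun x => hA l₀ hl₀ _).compl.inter (MeasurableSet.const _)
    · convert MeasurableSet.empty
      rw [Set.eq_empty_iff_forall_notMem]
      rintro ω ⟨h, -⟩
      exact hl₀ (h ▸ Nat.lt_succ_of_le (transcript_length_le (A ω) c t))

theorem measurableSet_outputs {Ω : Type*} [MeasurableSpace Ω] {A : Ω → Strategy X k}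
    (hA : ∀ hist out, MeasurableSet {ω | A ω hist = out}) (c : X → Fin k)
    (G : Fin k → Finset 𝒳) : MeasurableSet {ω | Outputs (A ω) c G} := by
  have heq : {ω | Outputs (A ω) c G} = ⋃ (t : ℕ) (l : List (X × Fin k)),
      {ω | transcript (A ω) c t = l} ∩ {ω | A ω l = Sum.inr G} := by
    ext ω
    simp [Outputs]
  rw [heq]
  exact MeasurableSet.iUnion fun t => MeasurableSet.iUnion fun l =>
    (measurableSet_transcript_eq c t (fun hist _ => hA hist) l).inter (hA _ _)

theorem measurableSet_queried {Ω : Type*} [MeasurableSpace Ω] {A : Ω → Strategy X k}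
    (hA : ∀ hist out, MeasurableSet {ω | A ω hist = out}) (c : X → Fin k) (x : X) :
    MeasurableSet {ω | Queried (A ω) c x} := by
  have heq : {ω | Queried (A ω) c x} = ⋃ (t : ℕ) (l : List (X × Fin k)),
      {ω | transcript (A ω) c t = l} ∩ {_ω | (x, c x) ∈ l} := by
    ext ω
    simp [Queried]
  rw [heq]
  exact MeasurableSet.iUnion fun t => MeasurableSet.iUnion fun l =>
    (measurableSet_transcript_eq c t (fun hist _ => hA hist) l).inter (MeasurableSet.const _)

theorem mem_cluster {i : Fin k} {x : 𝒳} : x ∈ cluster c i ↔ ∃ h : x ∈ X, c ⟨x, h⟩ = i := by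
  simp [cluster]

theorem cluster_injective : Function.Injective (cluster : (X → Fin k) → Fin k → Finset 𝒳) := by
  intro c c' h
  funext x
  have : x.1 ∈ cluster c' (c x) := h ▸ mem_cluster.2 ⟨x.2, rfl⟩
  obtain ⟨_, h'⟩ := mem_cluster.1 this
  exact h'.symm

end Runs

/-! ### The lower bound -/

section LowerBound

variable {𝒳 : Type*} {k : ℕ} {d : Fin k → PseudoMetricSpace 𝒳} {γ r : ℝ} {i j : Fin k} {z : 𝒳}
  {P : Finset 𝒳}

theorem hasMargin_const (hγ : 0 ≤ γ) (hr : 0 ≤ r) (hball : ∀ x ∈ P, (d j).dist x z ≤ r) :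
    HasMargin d γ (fun _ : P => j) := by
  intro l
  -- Cluster `j` lies in a ball of radius `r`; all the other clusters are empty.
  refine setHasMargin_of_dist_le hγ (D := if l = j then 2 * r else 0) (by split_ifs <;> positivity)
    (fun x hx y hy => ?_) (fun x hx hxl y hy => ?_)
  · obtain ⟨hxP, rfl⟩ := mem_cluster.1 hx
    obtain ⟨hyP, -⟩ := mem_cluster.1 hy
    let := d j
    have := dist_triangle_right x y z
    have h1 := hball x hxP
    have h2 := hball y hyP
    rw [if_pos rfl]
    linarith
  · obtain ⟨-, rfl⟩ := mem_cluster.1 hy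
    exact absurd (mem_cluster.2 ⟨hx, rfl⟩) hxl

/-- Cluster `j` has `d j`-diameter at most `2r`, which is why the packing is at scale `2γ`. Cluster
`i` is a singleton of diameter `0`, so it only needs positive `d i`-distance to the other points. -/
theorem hasMargin_update_const (hγ : 0 ≤ γ) (hr : 0 ≤ r) (hij : i ≠ j)
    (hball : ∀ x ∈ P, (d j).dist x z ≤ r)
    (hsep : ∀ x ∈ P, ∀ y ∈ P, x ≠ y → 2 * γ * r < (d j).dist x y ∧ 0 < (d i).dist x y)
    [DecidableEq P] (x₀ : P) :
    HasMargin d γ (Function.update (fun _ : P => j) x₀ i) := by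
  have hmem : ∀ (l : Fin k) (x : 𝒳), x ∈ cluster (Function.update (fun _ : P => j) x₀ i) l ↔
      x ∈ P ∧ (x = x₀ ∧ l = i ∨ x ≠ x₀ ∧ l = j) := by
    intro l x
    rw [mem_cluster]
    constructor
    · rintro ⟨hx, h⟩
      refine ⟨hx, ?_⟩
      by_cases hxx : x = x₀
      · subst hxx; simp_all
      · rw [Function.update_of_ne (by simpa [Subtype.ext_iff] using hxx)] at h
        exact Or.inr ⟨hxx, h.symm⟩
    · rintro ⟨hx, ⟨rfl, rfl⟩ | ⟨hxx, rfl⟩⟩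
      · exact ⟨hx, by simp⟩
      · exact ⟨hx, by rw [Function.update_of_ne (by simpa [Subtype.ext_iff] using hxx)]⟩
  intro l
  refine setHasMargin_of_dist_le hγ (D := if l = j then 2 * r else 0) (by split_ifs <;> positivity)
    (fun x hx y hy => ?_) (fun x hx hxl y hy => ?_)
  · rw [hmem] at hx hy
    obtain ⟨hxP, ⟨rfl, rfl⟩ | ⟨hxx, rfl⟩⟩ := hx
    · obtain ⟨-, ⟨rfl, -⟩ | ⟨-, h⟩⟩ := hy
      · let := d l
        rw [if_neg hij]
        exact (dist_self _).le
      · exact absurd h hij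
    · let := d l
      have := dist_triangle_right x y z
      have h1 := hball x hxP
      have h2 := hball y hy.1
      rw [if_pos rfl]
      linarith
  · rw [hmem] at hxl hy
    have hxy : x ≠ y := by rintro rfl; exact hxl hy
    obtain ⟨hyP, ⟨rfl, rfl⟩ | ⟨hyx, rfl⟩⟩ := hy
    · rw [if_neg hij, mul_zero]
      exact (hsep x hx _ hyP hxy).2
    · rw [if_pos rfl]
      have := (hsep x hx y hyP hxy).1
      linarith

theorem le_lintegral_numQueries {p : ℝ} (hp : 1 / 2 < p) (hγ : 0 ≤ γ) (hr : 0 ≤ r) (hij : i ≠ j)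
    (hball : ∀ x ∈ P, (d j).dist x z ≤ r)
    (hsep : ∀ x ∈ P, ∀ y ∈ P, x ≠ y → 2 * γ * r < (d j).dist x y ∧ 0 < (d i).dist x y)
    {Ω : Type*} [MeasurableSpace Ω] (μ : Measure Ω) [IsProbabilityMeasure μ]
    (A : Ω → Strategy P k) (hA : ∀ hist out, MeasurableSet {ω | A ω hist = out})
    (hcorrect : ∀ c : P → Fin k, HasMargin d γ c →
      ENNReal.ofReal p ≤ μ {ω | Outputs (A ω) c (cluster c)}) :
    ENNReal.ofReal (2 * p - 1) * P.card ≤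
      ∫⁻ ω, (numQueries (A ω) (fun _ : P => j) : ℝ≥0∞) ∂μ := by
  classical
  set c₀ : P → Fin k := fun _ => j
  have hq : ∀ x : P, ENNReal.ofReal (2 * p - 1) ≤ μ {ω | Queried (A ω) c₀ x} := by
    intro x
    set c₁ : P → Fin k := Function.update c₀ x i
    have hne : cluster c₁ ≠ cluster c₀ := by
      intro h
      have := congrFun (cluster_injective h) x
      simp only [c₁, c₀, Function.update_self] at this
      exact hij this
    have h0 := hcorrect c₀ (hasMargin_const hγ hr hball)
    have h1 := hcorrect c₁ (hasMargin_update_const hγ hr hij hball hsep x)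
    have hsub : {ω | Outputs (A ω) c₀ (cluster c₀)} ∩ {ω | Outputs (A ω) c₁ (cluster c₁)} ⊆
        {ω | Queried (A ω) c₀ x} := by
      rintro ω ⟨hω0, hω1⟩
      by_contra hx
      refine hne ((Outputs.congr (fun y hy => ?_) hx hω1).unique hω0)
      simp [c₁, Function.update_of_ne hy]
    -- Inclusion-exclusion: two events of probability at least `p` meet with probability at least
    -- `2p - 1`.
    have h2 := measure_union_add_inter {ω | Outputs (A ω) c₀ (cluster c₀)}
      (measurableSet_outputs hA c₁ (cluster c₁)) (μ := μ)
    have h3 : ENNReal.ofReal p + ENNReal.ofReal p ≤ 1 + μ {ω | Queried (A ω) c₀ x} :=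
      calc _ ≤ _ := add_le_add h0 h1
        _ = _ := h2.symm
        _ ≤ _ := add_le_add prob_le_one (measure_mono hsub)
    rw [← ENNReal.ofReal_add (by linarith) (by linarith)] at h3
    rw [ENNReal.ofReal_sub _ zero_le_one, ENNReal.ofReal_one, tsub_le_iff_left, two_mul]
    exact h3
  calc ENNReal.ofReal (2 * p - 1) * P.card
      = ∑ _x : P, ENNReal.ofReal (2 * p - 1) := by simp [mul_comm]
    _ ≤ ∑ x : P, μ {ω | Queried (A ω) c₀ x} := Finset.sum_le_sum fun x _ => hq x
    _ = ∑ x : P, ∫⁻ ω, {ω | Queried (A ω) c₀ x}.indicator 1 ω ∂μ :=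
        Finset.sum_congr rfl fun x _ =>
          (lintegral_indicator_one (measurableSet_queried hA c₀ x)).symm
    _ = ∫⁻ ω, ∑ x : P, {ω | Queried (A ω) c₀ x}.indicator 1 ω ∂μ :=
        (lintegral_finsetSum _ fun x _ =>
          measurable_one.indicator (measurableSet_queried hA c₀ x)).symm
    _ ≤ _ := by
        refine lintegral_mono fun ω => ?_
        have h : ∑ x : P, {ω | Queried (A ω) c₀ x}.indicator (1 : Ω → ℝ≥0∞) ω =
            ((Finset.univ.filter (Queried (A ω) c₀)).card : ℝ≥0∞) := by
          simp [Set.indicator_apply]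
        rw [h]
        exact ENat.toENNReal_le.2 (card_queried_le_numQueries (A ω) c₀)

end LowerBound

/-! ### MRECOVER only assigns correct labels -/

section Correctness

variable {𝒳 : Type*} {X : Finset 𝒳} {k : ℕ} {d : Fin k → PseudoMetricSpace 𝒳} {γ : ℝ} {m : ℕ}
  {c : X → Fin k}

theorem mem_samplePoints {S : List (X × Fin k)} {x : 𝒳} :
    x ∈ samplePoints S ↔ ∃ q ∈ S, q.1.1 = x := by
  simp [samplePoints]

theorem mem_sampleLabelled {S : List (X × Fin k)} {i : Fin k} {x : 𝒳} :
    x ∈ sampleLabelled S i ↔ ∃ q ∈ S, q.2 = i ∧ q.1.1 = x := by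
  simp only [sampleLabelled, mem_samplePoints, List.mem_filter, decide_eq_true_eq, and_assoc]

theorem mem_remaining {G : Fin k → Finset 𝒳} {x : 𝒳} :
    x ∈ remaining X G ↔ x ∈ X ∧ ∀ i, x ∉ G i := by
  simp [remaining]

theorem smallestConsistent_subset_cluster (hc : HasMargin d γ c) {Y : Finset 𝒳} (hYX : Y ⊆ X)
    {S : List (X × Fin k)} (hS : ∀ q ∈ S, q.1.1 ∈ Y ∧ q.2 = c q.1) (i : Fin k) :
    smallestConsistent (d i) γ Y S i ⊆ cluster c i := by
  classical
  intro x hx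
  rw [smallestConsistent, Finset.mem_filter] at hx
  have h := hx.2 (cluster c i ∩ Y) Finset.inter_subset_right
    ((hc i).mono Finset.inter_subset_left fun y hy hyn =>
      ⟨hYX hy, fun hyc => hyn (Finset.mem_inter.2 ⟨hyc, hy⟩)⟩) ?_
  · exact (Finset.mem_inter.1 h).1
  · ext y
    simp only [Finset.mem_inter, mem_samplePoints, mem_sampleLabelled]
    constructor
    · rintro ⟨⟨hyc, -⟩, q, hq, rfl⟩
      obtain ⟨_, h⟩ := mem_cluster.1 hyc
      exact ⟨q, hq, by rw [(hS q hq).2, ← h], rfl⟩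
    · rintro ⟨q, hq, rfl, rfl⟩
      exact ⟨⟨mem_cluster.2 ⟨q.1.2, (hS q hq).2.symm⟩, (hS q hq).1⟩, q, hq, rfl⟩

/-- The first `t` rounds read only the first `t * m` entries, so later answers do not alter them. -/
theorem labelledAfter_append (l l' : List (X × Fin k)) {t : ℕ} (ht : t * m ≤ l.length) :
    labelledAfter d γ m (l ++ l') t = labelledAfter d γ m l t := by
  induction t with
  | zero => rfl
  | succ t ih =>
    rw [Nat.succ_mul] at ht
    funext i
    have h : ((l ++ l').drop (t * m)).take m = (l.drop (t * m)).take m := by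
      rw [List.drop_append_of_le_length (by omega),
        List.take_append_of_le_length (by rw [List.length_drop]; omega)]
    simp only [labelledAfter, ih (by omega), h]

/-- Every point of the list is labelled by `c`, and was drawn from the points that remained at the
beginning of its round. -/
def ValidHistory (d : Fin k → PseudoMetricSpace 𝒳) (γ : ℝ) (m : ℕ) (c : X → Fin k)
    (l : List (X × Fin k)) : Prop :=
  ∀ s q, l[s]? = some q → q.1.1 ∈ remaining X (labelledAfter d γ m l (s / m)) ∧ q.2 = c q.1

theorem ValidHistory.labelledAfter_subset_cluster (hc : HasMargin d γ c)
    {l : List (X × Fin k)} (hl : ValidHistory d γ m c l) (t : ℕ) (i : Fin k) :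
    labelledAfter d γ m l t i ⊆ cluster c i := by
  classical
  induction t with
  | zero => simp [labelledAfter]
  | succ t ih =>
    rw [labelledAfter]
    refine Finset.union_subset ih
      (smallestConsistent_subset_cluster hc (remaining_subset _ _) (fun q hq => ?_) i)
    obtain ⟨n, hn⟩ := List.mem_iff_getElem?.1 hq
    rw [List.getElem?_take] at hn
    split_ifs at hn with hnm
    · rw [List.getElem?_drop] at hn
      have h := hl _ q hn
      rwa [Nat.mul_comm, Nat.mul_add_div (by omega), Nat.div_eq_of_lt hnm, add_zero] at h

/-- The points that remain after the rounds completed in the list of queries and answers. -/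
noncomputable def pool (d : Fin k → PseudoMetricSpace 𝒳) (γ : ℝ) (m : ℕ) (l : List (X × Fin k)) : Finset 𝒳 :=
  remaining X (labelledAfter d γ m l (l.length / m))

theorem pool_subset (l : List (X × Fin k)) : pool d γ m l ⊆ X := remaining_subset _ _

theorem mrecover_of_nonempty {a : ℝ} {ω : Draws 𝒳} {l : List (X × Fin k)}
    (h : (pool d γ (sampleSize a d γ) l).Nonempty) :
    mrecover a d γ X ω l = Sum.inl ⟨(ω (l.length, ⟨_, h⟩)).1, pool_subset l (ω (l.length, ⟨_, h⟩)).2⟩ :=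
  dif_pos h

theorem mrecover_of_empty {a : ℝ} {ω : Draws 𝒳} {l : List (X × Fin k)}
    (h : ¬ (pool d γ (sampleSize a d γ) l).Nonempty) :
    mrecover a d γ X ω l = Sum.inr
      (labelledAfter d γ (sampleSize a d γ) l (l.length / sampleSize a d γ)) :=
  dif_neg h

theorem validHistory_transcript (a : ℝ) (ω : Draws 𝒳) (t : ℕ) :
    ValidHistory d γ (sampleSize a d γ) c (transcript (mrecover a d γ X ω) c t) := by
  induction t with
  | zero => intro s q h; simp [transcript] at h
  | succ t ih =>
    by_cases hne : (pool d γ (sampleSize a d γ) (transcript (mrecover a d γ X ω) c t)).Nonempty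
    · rw [transcript_succ_of_inl (mrecover_of_nonempty hne)]
      intro s q hq
      rcases lt_trichotomy s (transcript (mrecover a d γ X ω) c t).length with hs | hs | hs
      · rw [List.getElem?_append_left hs] at hq
        rw [labelledAfter_append _ _ ((Nat.div_mul_le_self _ _).trans hs.le)]
        exact ih s q hq
      · subst hs
        rw [List.getElem?_append_right le_rfl] at hq
        simp only [Nat.sub_self, List.getElem?_cons_zero, Option.some.injEq] at hq
        subst hq
        rw [labelledAfter_append _ _ (Nat.div_mul_le_self _ _)]
        exact ⟨(ω (_, ⟨_, hne⟩)).2, rfl⟩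
      · rw [List.getElem?_eq_none (by simpa using hs)] at hq
        simp at hq
    · rwa [transcript_succ_of_inr (mrecover_of_empty hne)]

theorem outputs_cluster_of_empty {a : ℝ} (hc : HasMargin d γ c) {ω : Draws 𝒳} {t : ℕ}
    (h : ¬ (pool d γ (sampleSize a d γ) (transcript (mrecover a d γ X ω) c t)).Nonempty) :
    mrecover a d γ X ω (transcript (mrecover a d γ X ω) c t) = Sum.inr (cluster c) := by
  rw [mrecover_of_empty h]
  congr 1
  set G := labelledAfter d γ (sampleSize a d γ) (transcript (mrecover a d γ X ω) c t)
    ((transcript (mrecover a d γ X ω) c t).length / sampleSize a d γ)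
  have hG : ∀ i, G i ⊆ cluster c i :=
    (validHistory_transcript a ω t).labelledAfter_subset_cluster hc _
  funext i
  refine Finset.Subset.antisymm (hG i) fun x hx => ?_
  obtain ⟨hxX, hxi⟩ := mem_cluster.1 hx
  by_contra hxG
  refine h ⟨x, mem_remaining.2 ⟨hxX, fun j hj => ?_⟩⟩
  obtain ⟨_, hxj⟩ := mem_cluster.1 (hG j hj)
  rw [hxi] at hxj
  exact hxG (hxj ▸ hj)

theorem eq_cluster_of_outputs {a : ℝ} (hc : HasMargin d γ c) {ω : Draws 𝒳}
    {G : Fin k → Finset 𝒳} (h : Outputs (mrecover a d γ X ω) c G) : G = cluster c := by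
  obtain ⟨t, ht⟩ := h
  by_cases hne : (pool d γ (sampleSize a d γ) (transcript (mrecover a d γ X ω) c t)).Nonempty
  · rw [mrecover_of_nonempty hne] at ht
    simp at ht
  · rw [outputs_cluster_of_empty hc hne] at ht
    exact (Sum.inr.inj ht).symm

end Correctness

/-! ### The leave-one-out bound for a round -/

section LeaveOneOut

variable {𝒳 : Type*} {X : Finset 𝒳} {k : ℕ} {d : Fin k → PseudoMetricSpace 𝒳} {γ : ℝ} {m : ℕ}
  {c : X → Fin k}

/-- The sample of the points `v j` with their labels. -/
def labelledSample (c : X → Fin k) {Y : Finset 𝒳} (hY : Y ⊆ X) (v : Fin m → Y) :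
    List (X × Fin k) :=
  List.ofFn fun j => (⟨(v j).1, hY (v j).2⟩, c ⟨(v j).1, hY (v j).2⟩)

open Classical in
/-- The points of `Y` that get no label from the sample `S`. -/
noncomputable def unlabelled (d : Fin k → PseudoMetricSpace 𝒳) (γ : ℝ) (Y : Finset 𝒳) (S : List (X × Fin k)) :
    Finset 𝒳 :=
  Y.filter fun x => ∀ i, x ∉ smallestConsistent (d i) γ Y S i

-- Each missed position is charged to its true label. Within one label the consistent sets that omit
-- the missed points satisfy the hypotheses of `card_le_ballPacking_add_one`. Indexing by positions
-- takes care of repeated draws.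
open Classical in
theorem card_leaveOneOut_le (hγ : 0 < γ) (hM : maxPacking d γ ≠ ⊤) {Y : Finset 𝒳} (hY : Y ⊆ X)
    (w : Fin (m + 1) → Y) :
    (Finset.univ.filter fun j : Fin (m + 1) =>
      (w j).1 ∈ unlabelled d γ Y (labelledSample c hY (j.removeNth w))).card ≤
        k * ((maxPacking d γ).toNat + 1) := by
  set J : Fin k → Finset (Fin (m + 1)) := fun i => Finset.univ.filter fun j =>
    c ⟨(w j).1, hY (w j).2⟩ = i ∧
      (w j).1 ∉ smallestConsistent (d i) γ Y (labelledSample c hY (j.removeNth w)) i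
  have hJ : ∀ i, (J i).card ≤ (maxPacking d γ).toNat + 1 := by
    intro i
    have hex : ∀ j : Fin (m + 1), ∃ C : Finset 𝒳, j ∈ J i → SetHasMargin (d i) γ Y C ∧
        C ∩ samplePoints (labelledSample c hY (j.removeNth w)) =
          sampleLabelled (labelledSample c hY (j.removeNth w)) i ∧ (w j).1 ∉ C := by
      intro j
      by_cases hj : j ∈ J i
      · have h := (Finset.mem_filter.1 hj).2.2
        rw [smallestConsistent, Finset.mem_filter] at h
        push Not at h
        obtain ⟨C, -, h1, h2, h3⟩ := h (w j).2
        exact ⟨C, fun _ => ⟨h1, h2, h3⟩⟩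
      · exact ⟨∅, fun h => absurd h hj⟩
    choose C hC using hex
    have h1 := card_le_ballPacking_add_one hγ (J i) (fun j => (w j).1) Y C (fun j hj => (hC j hj).1)
      (fun j _ => (w j).2) (fun j hj => (hC j hj).2.2) fun j hj l hl hlj => by
        obtain ⟨l', rfl⟩ := Fin.exists_succAbove_eq hlj
        have hmem : (w (j.succAbove l')).1 ∈
            sampleLabelled (labelledSample c hY (j.removeNth w)) i :=
          mem_sampleLabelled.2 ⟨_, List.mem_ofFn.2 ⟨l', rfl⟩, (Finset.mem_filter.1 hl).2.1, rfl⟩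
        rw [← (hC j hj).2.1] at hmem
        exact (Finset.mem_inter.1 hmem).1
    have h2 : ((J i).card : ℕ∞) ≤ maxPacking d γ + 1 :=
      h1.trans (by gcongr; exact le_iSup (fun i => ballPacking (d i) γ) i)
    rw [← ENat.natCast_toNat hM] at h2
    exact_mod_cast h2
  calc _ ≤ (Finset.univ.biUnion J).card := by
        refine Finset.card_le_card fun j hj => ?_
        have h := (Finset.mem_filter.1 (Finset.mem_filter.1 hj).2).2
        exact Finset.mem_biUnion.2 ⟨_, Finset.mem_univ _, Finset.mem_filter.2
          ⟨Finset.mem_univ _, rfl, h _⟩⟩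
    _ ≤ ∑ i, (J i).card := Finset.card_biUnion_le
    _ ≤ ∑ _i : Fin k, ((maxPacking d γ).toNat + 1) := Finset.sum_le_sum fun i _ => hJ i
    _ = _ := by simp

/-- The expectation bound for one round, as a count: dividing by `(m + 1) * Y.card ^ m` gives the
mean number of unlabelled points. A sample and a test point form a tuple of length `m + 1`, with the
test point at any position `j`; summing over `j` brings in the leave-one-out bound. -/
theorem sum_card_unlabelled_le (hγ : 0 < γ) (hM : maxPacking d γ ≠ ⊤) {Y : Finset 𝒳}
    (hY : Y ⊆ X) :
    (m + 1) * ∑ v : Fin m → Y, (unlabelled d γ Y (labelledSample c hY v)).card ≤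
      k * ((maxPacking d γ).toNat + 1) * Y.card ^ (m + 1) := by
  classical
  have hcard : ∀ v : Fin m → Y, (unlabelled d γ Y (labelledSample c hY v)).card =
      ∑ y : Y, if y.1 ∈ unlabelled d γ Y (labelledSample c hY v) then 1 else 0 := by
    intro v
    rw [Finset.sum_coe_sort Y fun y =>
      if y ∈ unlabelled d γ Y (labelledSample c hY v) then 1 else 0,
      Finset.sum_boole, Nat.cast_id, Finset.filter_mem_eq_inter,
      Finset.inter_eq_right.2 (show unlabelled d γ Y _ ⊆ Y from Finset.filter_subset _ _)]
  have hj : ∀ j : Fin (m + 1), ∑ v : Fin m → Y, (unlabelled d γ Y (labelledSample c hY v)).card =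
      ∑ w : Fin (m + 1) → Y,
        if (w j).1 ∈ unlabelled d γ Y (labelledSample c hY (j.removeNth w)) then 1 else 0 := by
    intro j
    simp_rw [hcard]
    rw [Finset.sum_comm, ← Fintype.sum_prod_type', ← (Fin.insertNthEquiv (fun _ => Y) j).sum_comp]
    refine Finset.sum_congr rfl fun p _ => ?_
    simp [Fin.insertNthEquiv]
  calc (m + 1) * ∑ v : Fin m → Y, (unlabelled d γ Y (labelledSample c hY v)).card
      = ∑ j : Fin (m + 1), ∑ v : Fin m → Y, (unlabelled d γ Y (labelledSample c hY v)).card := by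
        simp
    _ = ∑ w : Fin (m + 1) → Y, ∑ j : Fin (m + 1),
        if (w j).1 ∈ unlabelled d γ Y (labelledSample c hY (j.removeNth w)) then 1 else 0 := by
        rw [Finset.sum_comm (γ := Fin (m + 1) → Y)]
        exact Finset.sum_congr rfl fun j _ => hj j
    _ ≤ ∑ _w : Fin (m + 1) → Y, k * ((maxPacking d γ).toNat + 1) := by
        refine Finset.sum_le_sum fun w _ => ?_
        rw [Finset.sum_boole, Nat.cast_id]
        exact card_leaveOneOut_le hγ hM hY w
    _ = _ := by simp [mul_comm]

theorem pool_append_of_lt {l l' : List (X × Fin k)} {r : ℕ} (hl : l.length = r * m)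
    (hl' : l'.length < m) : pool d γ m (l ++ l') = pool d γ m l := by
  have h1 : (l ++ l').length / m = r := by
    rw [List.length_append, hl, Nat.mul_comm, Nat.mul_add_div (by omega), Nat.div_eq_of_lt hl', add_zero]
  have h2 : l.length / m = r := by rw [hl, Nat.mul_div_cancel _ (by omega)]
  rw [pool, pool, h1, h2, labelledAfter_append _ _ hl.ge]

theorem pool_append_of_eq (hm : 0 < m) {l l' : List (X × Fin k)} {r : ℕ} (hl : l.length = r * m)
    (hl' : l'.length = m) : pool d γ m (l ++ l') = unlabelled d γ (pool d γ m l) l' := by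
  have h1 : (l ++ l').length / m = r + 1 := by
    rw [List.length_append, hl, hl', ← Nat.succ_mul, Nat.mul_div_cancel _ hm]
  have h2 : l.length / m = r := by rw [hl, Nat.mul_div_cancel _ hm]
  have h3 : ((l ++ l').drop (r * m)).take m = l' := by
    rw [← hl, List.drop_left, ← hl', List.take_length]
  classical
  ext x
  rw [unlabelled, Finset.mem_filter]
  simp only [pool, h1, h2, mem_remaining, labelledAfter, Finset.mem_union,
    labelledAfter_append _ _ hl.ge, h3, not_or, forall_and, and_assoc]

end LeaveOneOut

/-! ### The random draws -/

section Draws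

variable {𝒳 : Type*}

/-- The events that are determined by the draws with indices in `s`. -/
@[reducible]
def drawsIn (s : Set (ℕ × {Y : Finset 𝒳 // Y.Nonempty})) : MeasurableSpace (Draws 𝒳) :=
  ⨆ p ∈ s, MeasurableSpace.comap (fun ω : Draws 𝒳 => ω p) ⊤

theorem measurableSet_drawsIn {s : Set (ℕ × {Y : Finset 𝒳 // Y.Nonempty})}
    {p : ℕ × {Y : Finset 𝒳 // Y.Nonempty}} (hp : p ∈ s) (f : p.2.1 → Prop) :
    MeasurableSet[drawsIn s] {ω : Draws 𝒳 | f (ω p)} :=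
  (le_iSup₂_of_le p hp le_rfl : MeasurableSpace.comap (fun ω : Draws 𝒳 => ω p) ⊤ ≤ drawsIn s) _
    ⟨{y | f y}, trivial, rfl⟩

theorem drawsIn_le (s : Set (ℕ × {Y : Finset 𝒳 // Y.Nonempty})) :
    drawsIn s ≤ drawsMeasurableSpace 𝒳 :=
  iSup₂_le fun p _ => le_iSup (fun p => MeasurableSpace.comap (fun ω : Draws 𝒳 => ω p) ⊤) p

theorem indep_drawsIn {s t : Set (ℕ × {Y : Finset 𝒳 // Y.Nonempty})} (hst : Disjoint s t) :
    ProbabilityTheory.Indep (drawsIn s) (drawsIn t) (drawLaw 𝒳) := by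
  let : ∀ p : ℕ × {Y : Finset 𝒳 // Y.Nonempty}, MeasurableSpace p.2.1 := fun _ => ⊤
  have : ∀ p : ℕ × {Y : Finset 𝒳 // Y.Nonempty}, IsProbabilityMeasure (uniformDraw p.2) :=
    fun p => PMF.toMeasure.isProbabilityMeasure _
  have h := ProbabilityTheory.iIndepFun_infinitePi
    (P := fun p : ℕ × {Y : Finset 𝒳 // Y.Nonempty} => uniformDraw p.2) (X := fun _ y => y)
    (fun _ => measurable_id)
  exact ProbabilityTheory.indep_iSup_of_disjoint
    (fun p => le_iSup (fun p => MeasurableSpace.comap (fun ω : Draws 𝒳 => ω p) ⊤) p)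
    ((ProbabilityTheory.iIndepFun_iff_iIndep _ _ _).1 h) hst

theorem uniformDraw_singleton (Y : {Y : Finset 𝒳 // Y.Nonempty}) (y : Y.1) :
    uniformDraw Y {y} = (Y.1.card : ℝ≥0∞)⁻¹ := by
  let : MeasurableSpace Y.1 := ⊤
  rw [uniformDraw, PMF.toMeasure_apply_singleton _ _ (MeasurableSet.singleton y)]
  simp

theorem drawLaw_block (Y : {Y : Finset 𝒳 // Y.Nonempty}) (n : ℕ) {m : ℕ} (v : Fin m → Y.1) :
    drawLaw 𝒳 {ω | ∀ j : Fin m, ω (n + j, Y) = v j} = ((Y.1.card : ℝ≥0∞)⁻¹) ^ m := by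
  classical
  let : ∀ p : ℕ × {Y : Finset 𝒳 // Y.Nonempty}, MeasurableSpace p.2.1 := fun _ => ⊤
  have : ∀ p : ℕ × {Y : Finset 𝒳 // Y.Nonempty}, IsProbabilityMeasure (uniformDraw p.2) :=
    fun p => PMF.toMeasure.isProbabilityMeasure _
  let e : Fin m ↪ ℕ × {Y : Finset 𝒳 // Y.Nonempty} :=
    ⟨fun j => (n + j, Y), fun i j h => by simpa [Fin.ext_iff] using h⟩
  -- Comparing values in `𝒳` avoids transport between the dependent types of the draws.
  let t : (p : ℕ × {Y : Finset 𝒳 // Y.Nonempty}) → Set p.2.1 :=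
    fun p => {y | ∀ j : Fin m, p = e j → y.1 = (v j).1}
  have ht : ∀ j, t (e j) = {v j} := by
    intro j
    ext y
    constructor
    · intro h
      exact Subtype.ext (h j rfl)
    · rintro rfl i hi
      rw [e.injective hi]
  have hset : {ω : Draws 𝒳 | ∀ j : Fin m, ω (n + j, Y) = v j} =
      Set.pi (Finset.univ.map e : Finset _) t := by
    ext ω
    simp only [Set.mem_pi, Finset.mem_coe, Finset.mem_map, Finset.mem_univ, true_and,
      forall_exists_index, forall_apply_eq_imp_iff, ht]
    rfl
  calc drawLaw 𝒳 {ω | ∀ j : Fin m, ω (n + j, Y) = v j}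
      = drawLaw 𝒳 (Set.pi (Finset.univ.map e : Finset _) t) := congrArg _ hset
    _ = ∏ p ∈ Finset.univ.map e, uniformDraw p.2 (t p) :=
        Measure.infinitePi_pi (fun p : ℕ × {Y : Finset 𝒳 // Y.Nonempty} => uniformDraw p.2)
          (fun _ _ => MeasurableSpace.measurableSet_top)
    _ = ∏ j : Fin m, uniformDraw Y (t (e j)) := Finset.prod_map _ _ _
    _ = ∏ _j : Fin m, (Y.1.card : ℝ≥0∞)⁻¹ :=
        Finset.prod_congr rfl fun j _ => by rw [ht]; exact uniformDraw_singleton Y (v j)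
    _ = _ := by simp

end Draws

/-! ### The expected number of points that remain -/

section Rounds

variable {𝒳 : Type*} {X : Finset 𝒳} {k : ℕ} {d : Fin k → PseudoMetricSpace 𝒳} {γ a : ℝ}
  {c : X → Fin k}

theorem measurableSet_mrecover_eq {n : ℕ} {l : List (X × Fin k)} (hl : l.length < n)
    (out : X ⊕ (Fin k → Finset 𝒳)) :
    MeasurableSet[drawsIn {p | p.1 < n}] {ω : Draws 𝒳 | mrecover a d γ X ω l = out} := by
  by_cases h : (pool d γ (sampleSize a d γ) l).Nonempty
  · simp_rw [mrecover_of_nonempty h]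
    exact measurableSet_drawsIn (p := (l.length, ⟨_, h⟩)) hl
      fun y => Sum.inl ⟨y.1, pool_subset l y.2⟩ = out
  · simp_rw [mrecover_of_empty h]
    exact @MeasurableSet.const _ (drawsIn {p | p.1 < n}) _

theorem measurableSet_run_eq (n : ℕ) (l : List (X × Fin k)) :
    MeasurableSet[drawsIn {p | p.1 < n}]
      {ω : Draws 𝒳 | transcript (mrecover a d γ X ω) c n = l} :=
  @measurableSet_transcript_eq _ _ _ _ (drawsIn {p | p.1 < n}) _ c n
    (fun _ hh out => measurableSet_mrecover_eq hh out) l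

/-- In the round that begins with the list `l`, the points queried are the draws for the pool of
`l`. -/
theorem transcript_round {l : List (X × Fin k)} {r : ℕ} {ω : Draws 𝒳}
    (hl : l.length = r * sampleSize a d γ)
    (hrun : transcript (mrecover a d γ X ω) c (r * sampleSize a d γ) = l)
    (hne : (pool d γ (sampleSize a d γ) l).Nonempty) (j : ℕ) (hj : j ≤ sampleSize a d γ) :
    transcript (mrecover a d γ X ω) c (r * sampleSize a d γ + j) =
      l ++ labelledSample c (pool_subset l)
        fun s : Fin j => ω (r * sampleSize a d γ + s, ⟨_, hne⟩) := by
  induction j with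
  | zero => simp [hrun, labelledSample]
  | succ j ih =>
    specialize ih (by omega)
    set l' := labelledSample c (pool_subset l)
      fun s : Fin j => ω (r * sampleSize a d γ + s, ⟨_, hne⟩)
    have hl' : l'.length = j := by simp [l', labelledSample]
    have hpool := pool_append_of_lt (d := d) (γ := γ) hl (l' := l') (by omega)
    have hlen : (l ++ l').length = r * sampleSize a d γ + j := by rw [List.length_append, hl, hl']
    -- The type of a draw depends on its pool; generalizing the pool and the time lets the
    -- equalities be substituted.
    have hstep : ∀ (Y : Finset 𝒳) (hY : Y.Nonempty) (hYX : Y ⊆ X) (n : ℕ),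
        Y = pool d γ (sampleSize a d γ) l → n = r * sampleSize a d γ + j →
        (⟨(ω (n, ⟨Y, hY⟩)).1, hYX (ω (n, ⟨Y, hY⟩)).2⟩ : X) =
          ⟨(ω (r * sampleSize a d γ + j, ⟨_, hne⟩)).1,
            pool_subset l (ω (r * sampleSize a d γ + j, ⟨_, hne⟩)).2⟩ := by
      rintro Y hY hYX n rfl rfl
      rfl
    have hne' : (pool d γ (sampleSize a d γ) (l ++ l')).Nonempty := hpool ▸ hne
    have hm := mrecover_of_nonempty (ω := ω) hne'
    rw [hstep _ hne' (pool_subset _) _ hpool hlen] at hm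
    rw [← add_assoc, transcript_succ_of_inl (ih ▸ hm), ih, List.append_assoc]
    congr 1
    simp only [labelledSample, List.ofFn_succ', List.concat_eq_append, l']
    rfl

/-- One-round contraction, conditional on the past `l`. Fixing `l` fixes the pool, and the next
block of draws for that pool is uniform and independent of the event that the past is `l`. -/
theorem lintegral_card_pool_succ_le (hγ : 0 < γ) (hM : maxPacking d γ ≠ ⊤)
    (hm : 0 < sampleSize a d γ) {ρ : ℝ≥0∞}
    (hρ : (k : ℝ≥0∞) * ((maxPacking d γ).toNat + 1) ≤ ρ * (sampleSize a d γ + 1)) (r : ℕ)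
    (l : List (X × Fin k)) :
    ∫⁻ ω in {ω | transcript (mrecover a d γ X ω) c (r * sampleSize a d γ) = l},
        ((pool d γ (sampleSize a d γ)
          (transcript (mrecover a d γ X ω) c ((r + 1) * sampleSize a d γ))).card : ℝ≥0∞)
          ∂(drawLaw 𝒳) ≤
      ρ * (drawLaw 𝒳 {ω | transcript (mrecover a d γ X ω) c (r * sampleSize a d γ) = l} *
        (pool d γ (sampleSize a d γ) l).card) := by
  classical
  set m := sampleSize a d γ
  set E := {ω : Draws 𝒳 | transcript (mrecover a d γ X ω) c (r * m) = l}
  have hE : MeasurableSet E := drawsIn_le _ _ (measurableSet_run_eq (r * m) l)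
  by_cases hne : (pool d γ m l).Nonempty
  swap
  · have h0 : ∀ ω ∈ E, ((pool d γ m
        (transcript (mrecover a d γ X ω) c ((r + 1) * m))).card : ℝ≥0∞) = 0 := by
      intro ω hω
      have hω' : transcript (mrecover a d γ X ω) c (r * m) = l := hω
      rw [transcript_eq_of_stopped (Nat.mul_le_mul_right m (Nat.le_succ r))
        (mrecover_of_empty (by rw [hω']; exact hne)), hω', Finset.not_nonempty_iff_eq_empty.1 hne]
      simp
    rw [setLIntegral_congr_fun hE h0]
    simp
  by_cases hlen : l.length = r * m
  swap
  -- With a nonempty pool the run has not stopped, so its transcript has full length.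
  · have hempty : E = ∅ := by
      rw [Set.eq_empty_iff_forall_notMem]
      intro ω hω
      have hω' : transcript (mrecover a d γ X ω) c (r * m) = l := hω
      refine hlen (hω' ▸ transcript_length_of_not_stopped ?_)
      rw [hω', mrecover_of_nonempty hne]
      rfl
    rw [hempty]
    simp
  set Y : {Y : Finset 𝒳 // Y.Nonempty} := ⟨pool d γ m l, hne⟩
  let V : (Fin m → Y.1) → Set (Draws 𝒳) := fun v => {ω | ∀ j : Fin m, ω (r * m + j, Y) = v j}
  let u : (Fin m → Y.1) → ℕ := fun v =>
    (unlabelled d γ Y.1 (labelledSample c (pool_subset l) v)).card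
  have hVfut : ∀ v, MeasurableSet[drawsIn {p | r * m ≤ p.1}] (V v) := by
    intro v
    simp only [V, Set.ofPred_forall]
    refine @MeasurableSet.iInter _ _ (drawsIn _) _ _ fun j => ?_
    exact measurableSet_drawsIn (p := (r * m + j, Y)) (Nat.le_add_right _ _) fun y => y = v j
  have hV : ∀ v, MeasurableSet (V v) := fun v => drawsIn_le _ _ (hVfut v)
  have hEV : ∀ v, drawLaw 𝒳 (V v ∩ E) = drawLaw 𝒳 E * ((Y.1.card : ℝ≥0∞)⁻¹) ^ m := by
    intro v
    have hdisj : Disjoint {p : ℕ × {Y : Finset 𝒳 // Y.Nonempty} | p.1 < r * m}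
        {p | r * m ≤ p.1} :=
      Set.disjoint_left.2 fun p (h1 : p.1 < r * m) (h2 : r * m ≤ p.1) => absurd h1 h2.not_gt
    rw [Set.inter_comm, (ProbabilityTheory.Indep_iff _ _ _).1 (indep_drawsIn hdisj) E (V v)
      (measurableSet_run_eq (r * m) l) (hVfut v), drawLaw_block]
  have hfun : ∀ ω ∈ E, ((pool d γ m
      (transcript (mrecover a d γ X ω) c ((r + 1) * m))).card : ℝ≥0∞) =
        ∑ v, (V v).indicator (fun _ => (u v : ℝ≥0∞)) ω := by
    intro ω hω
    rw [Finset.sum_eq_single (fun j : Fin m => ω (r * m + j, Y)), Set.indicator_of_mem,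
      Nat.succ_mul, transcript_round hlen hω hne m le_rfl,
      pool_append_of_eq hm hlen (by simp [labelledSample])]
    · exact fun _ => rfl
    · intro v _ hv
      exact Set.indicator_of_notMem (fun h => hv (funext fun j => (h j).symm)) _
    · simp
  have hsum : (∑ v, (u v : ℝ≥0∞)) ≤ ρ * (Y.1.card : ℝ≥0∞) ^ (m + 1) := by
    have h := sum_card_unlabelled_le (m := m) (c := c) hγ hM (pool_subset (d := d) (γ := γ)
      (m := m) l)
    have h' : ((m : ℝ≥0∞) + 1) * ∑ v, (u v : ℝ≥0∞) ≤
        k * ((maxPacking d γ).toNat + 1) * (Y.1.card : ℝ≥0∞) ^ (m + 1) := by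
      exact_mod_cast h
    have h2 : ((m : ℝ≥0∞) + 1) * ∑ v, (u v : ℝ≥0∞) ≤
        ((m : ℝ≥0∞) + 1) * (ρ * (Y.1.card : ℝ≥0∞) ^ (m + 1)) :=
      h'.trans ((mul_le_mul_left hρ _).trans_eq (by ring))
    exact (ENNReal.mul_le_mul_iff_right (by simp) (by simp)).1 h2
  have hY0 : (Y.1.card : ℝ≥0∞) ≠ 0 := by exact_mod_cast Y.2.card_pos.ne'
  calc _ = ∫⁻ ω in E, ∑ v, (V v).indicator (fun _ => (u v : ℝ≥0∞)) ω ∂(drawLaw 𝒳) :=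
        setLIntegral_congr_fun hE hfun
    _ = ∑ v, (u v : ℝ≥0∞) * (drawLaw 𝒳 E * ((Y.1.card : ℝ≥0∞)⁻¹) ^ m) := by
        rw [lintegral_finsetSum _ fun v _ => measurable_const.indicator (hV v)]
        refine Finset.sum_congr rfl fun v _ => ?_
        rw [lintegral_indicator_const (hV v), Measure.restrict_apply (hV v), hEV]
    _ = (∑ v, (u v : ℝ≥0∞)) * (drawLaw 𝒳 E * ((Y.1.card : ℝ≥0∞)⁻¹) ^ m) :=
        (Finset.sum_mul _ _ _).symm
    _ ≤ ρ * (Y.1.card : ℝ≥0∞) ^ (m + 1) * (drawLaw 𝒳 E * ((Y.1.card : ℝ≥0∞)⁻¹) ^ m) :=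
        mul_le_mul_left hsum _
    _ = ρ * (drawLaw 𝒳 E * Y.1.card) *
          ((Y.1.card : ℝ≥0∞) ^ m * ((Y.1.card : ℝ≥0∞)⁻¹) ^ m) := by ring
    _ = _ := by
        rw [← mul_pow, ENNReal.mul_inv_cancel hY0 (by simp), one_pow, mul_one]

theorem lintegral_run (n n' : ℕ) (f : List (X × Fin k) → ℝ≥0∞) :
    ∫⁻ ω, f (transcript (mrecover a d γ X ω) c n') ∂(drawLaw 𝒳) =
      ∑' l, ∫⁻ ω in {ω | transcript (mrecover a d γ X ω) c n = l},
        f (transcript (mrecover a d γ X ω) c n') ∂(drawLaw 𝒳) := by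
  have hU : (⋃ l : List (X × Fin k), {ω : Draws 𝒳 | transcript (mrecover a d γ X ω) c n = l}) =
      Set.univ := by
    ext ω; simp
  rw [← lintegral_iUnion (fun l => drawsIn_le _ _ (measurableSet_run_eq n l)), hU,
    setLIntegral_univ]
  intro l l' hll
  exact Set.disjoint_left.2 fun ω h h' => hll (Eq.trans (Eq.symm h) h')

theorem lintegral_card_pool_le (hγ : 0 < γ) (hM : maxPacking d γ ≠ ⊤)
    (hm : 0 < sampleSize a d γ) {ρ : ℝ≥0∞}
    (hρ : (k : ℝ≥0∞) * ((maxPacking d γ).toNat + 1) ≤ ρ * (sampleSize a d γ + 1)) (r : ℕ) :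
    ∫⁻ ω, ((pool d γ (sampleSize a d γ)
        (transcript (mrecover a d γ X ω) c (r * sampleSize a d γ))).card : ℝ≥0∞) ∂(drawLaw 𝒳) ≤
      ρ ^ r * X.card := by
  induction r with
  | zero =>
    simp only [Nat.zero_mul, transcript, pow_zero, one_mul, lintegral_const, measure_univ, mul_one]
    exact_mod_cast Finset.card_le_card (pool_subset _)
  | succ r ih =>
    calc _ ≤ ∑' l, ρ * (drawLaw 𝒳
            {ω | transcript (mrecover a d γ X ω) c (r * sampleSize a d γ) = l} *
              (pool d γ (sampleSize a d γ) l).card) := by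
          rw [lintegral_run (r * sampleSize a d γ) _ fun l =>
            ((pool d γ (sampleSize a d γ) l).card : ℝ≥0∞)]
          exact ENNReal.tsum_le_tsum fun l => lintegral_card_pool_succ_le hγ hM hm hρ r l
      _ = ρ * ∫⁻ ω, ((pool d γ (sampleSize a d γ)
            (transcript (mrecover a d γ X ω) c (r * sampleSize a d γ))).card : ℝ≥0∞)
              ∂(drawLaw 𝒳) := by
          rw [ENNReal.tsum_mul_left, lintegral_run (r * sampleSize a d γ) _ fun l =>
            ((pool d γ (sampleSize a d γ) l).card : ℝ≥0∞)]
          congr 1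
          refine tsum_congr fun l => ?_
          rw [setLIntegral_congr_fun (g := fun _ => ((pool d γ (sampleSize a d γ) l).card : ℝ≥0∞))
            (drawsIn_le _ _ (measurableSet_run_eq _ l)) (fun ω hω => by
              rw [show transcript (mrecover a d γ X ω) c (r * sampleSize a d γ) = l from hω]),
            setLIntegral_const, mul_comm]
      _ ≤ ρ * (ρ ^ r * X.card) := mul_le_mul_right ih _
      _ = _ := by rw [pow_succ]; ring

/-- The probability that points remain after `r` rounds. -/
theorem drawLaw_pool_nonempty_le (hγ : 0 < γ) (hM : maxPacking d γ ≠ ⊤)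
    (hm : 0 < sampleSize a d γ) {ρ : ℝ≥0∞}
    (hρ : (k : ℝ≥0∞) * ((maxPacking d γ).toNat + 1) ≤ ρ * (sampleSize a d γ + 1)) (r : ℕ) :
    drawLaw 𝒳 {ω | (pool d γ (sampleSize a d γ)
        (transcript (mrecover a d γ X ω) c (r * sampleSize a d γ))).Nonempty} ≤
      ρ ^ r * X.card := by
  refine le_trans ?_ (lintegral_card_pool_le (c := c) hγ hM hm hρ r)
  set F := {ω | (pool d γ (sampleSize a d γ)
    (transcript (mrecover a d γ X ω) c (r * sampleSize a d γ))).Nonempty}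
  have hF : MeasurableSet F := by
    have heq : F = ⋃ l : List (X × Fin k),
        {ω : Draws 𝒳 | transcript (mrecover a d γ X ω) c (r * sampleSize a d γ) = l} ∩
          {_ω | (pool d γ (sampleSize a d γ) l).Nonempty} := by
      ext ω; simp [F]
    rw [heq]
    exact MeasurableSet.iUnion fun l =>
      (drawsIn_le _ _ (measurableSet_run_eq _ l)).inter (MeasurableSet.const _)
  rw [← lintegral_indicator_one hF]
  -- Markov's inequality at level `1`: a nonempty pool has at least one point.
  refine lintegral_mono fun ω => ?_
  rw [Set.indicator_apply]
  split_ifs with hω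
  · exact Nat.one_le_cast.2 (Nat.succ_le_of_lt (Finset.card_pos.2 hω))
  · exact zero_le

end Rounds

/-! ### The upper bound -/

section UpperBound

variable {𝒳 : Type*} {X : Finset 𝒳} {k : ℕ} {d : Fin k → PseudoMetricSpace 𝒳} {γ a : ℝ}
  {c : X → Fin k}

theorem one_le_packingParam_mul_log (hk : 2 ≤ k) :
    1 ≤ (packingParam d γ : ℝ) * k * Real.log k := by
  have hk' : (2 : ℝ) ≤ k := by exact_mod_cast hk
  have hM : (2 : ℝ) ≤ packingParam d γ := by exact_mod_cast le_max_left _ _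
  have hlog : Real.log 2 ≤ Real.log k := Real.log_le_log two_pos hk'
  have h2 := Real.log_two_gt_d9
  have h4 : (4 : ℝ) ≤ packingParam d γ * k := by nlinarith
  nlinarith

theorem le_sampleSize (a : ℝ) (d : Fin k → PseudoMetricSpace 𝒳) (γ : ℝ) :
    a * (packingParam d γ * k * Real.log k) ≤ sampleSize a d γ := by
  have h := Nat.le_ceil (a * packingParam d γ * k * Real.log k)
  rw [sampleSize]
  linarith

theorem sampleSize_le (hk : 2 ≤ k) (ha : 0 ≤ a) :
    (sampleSize a d γ : ℝ) ≤ (a + 1) * (packingParam d γ * k * Real.log k) := by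
  have h1 := one_le_packingParam_mul_log (d := d) (γ := γ) hk
  have h := Nat.ceil_lt_add_one (a := a * packingParam d γ * k * Real.log k)
    (by have := mul_nonneg ha (zero_le_one.trans h1); linarith)
  rw [sampleSize]
  linarith

theorem sampleSize_pos (hk : 2 ≤ k) (ha : 0 < a) : 0 < sampleSize a d γ := by
  have h1 := one_le_packingParam_mul_log (d := d) (γ := γ) hk
  have h := le_sampleSize a d γ
  have : (0 : ℝ) < sampleSize a d γ := by nlinarith
  exact_mod_cast this

/-- With `M = packingParam d γ`, the left side is at most `2 M k`. The sample size is at least `10 *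
0.6 * M k`, as `log k ≥ log 2 > 0.6`, and `6 * exp (-1) > 2`. -/
theorem packing_le_exp_mul_sampleSize (hk : 2 ≤ k) (ha : 10 ≤ a) :
    (k : ℝ≥0∞) * ((maxPacking d γ).toNat + 1) ≤
      ENNReal.ofReal (Real.exp (-1)) * (sampleSize a d γ + 1) := by
  have hk' : (2 : ℝ) ≤ k := by exact_mod_cast hk
  have hlog : Real.log 2 ≤ Real.log k := Real.log_le_log two_pos hk'
  have h2 := Real.log_two_gt_d9
  have he := Real.exp_neg_one_gt_d9
  have hM2 : (2 : ℝ) ≤ packingParam d γ := by exact_mod_cast le_max_left _ _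
  have hM : ((maxPacking d γ).toNat : ℝ) ≤ packingParam d γ := by exact_mod_cast le_max_right _ _
  have hs := le_sampleSize a d γ
  have hMk : (0 : ℝ) < packingParam d γ * k := by nlinarith
  have h3 : 6 * (packingParam d γ * k : ℝ) ≤ sampleSize a d γ := by
    have h5 : (0.6 : ℝ) * (packingParam d γ * k) ≤ packingParam d γ * k * Real.log k := by
      nlinarith
    nlinarith
  have h4 : (k : ℝ) * ((maxPacking d γ).toNat + 1) ≤ 2 * (packingParam d γ * k) := by nlinarith
  have h6 : (k : ℝ) * ((maxPacking d γ).toNat + 1) ≤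
      Real.exp (-1) * (sampleSize a d γ + 1) := by
    nlinarith
  have h7 := ENNReal.ofReal_le_ofReal h6
  rw [ENNReal.ofReal_mul (by positivity), ENNReal.ofReal_mul (by positivity),
    ENNReal.ofReal_natCast, ENNReal.ofReal_add (by positivity) zero_le_one,
    ENNReal.ofReal_add (by positivity) zero_le_one] at h7
  simpa using h7

theorem ae_outputs_cluster (hk : 2 ≤ k) (ha : 10 ≤ a) (hγ : 0 < γ) (hM : maxPacking d γ ≠ ⊤)
    (hc : HasMargin d γ c) :
    ∀ᵐ ω ∂(drawLaw 𝒳), Outputs (mrecover a d γ X ω) c (cluster c) := by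
  rw [ae_iff]
  refine le_antisymm ?_ zero_le
  have hlim := ENNReal.Tendsto.mul_const (b := (X.card : ℝ≥0∞))
    (ENNReal.tendsto_pow_atTop_nhds_zero_of_lt_one (r := ENNReal.ofReal (Real.exp (-1)))
      (by rw [← ENNReal.ofReal_one, ENNReal.ofReal_lt_ofReal_iff one_pos]; simp))
    (Or.inr (by simp))
  rw [zero_mul] at hlim
  -- A run that fails to output the clustering has a nonempty pool after every number `r` of rounds.
  refine ge_of_tendsto' hlim fun r => le_trans (measure_mono fun ω hω => ?_)
    (drawLaw_pool_nonempty_le (c := c) hγ hM (sampleSize_pos hk (by linarith))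
      (packing_le_exp_mul_sampleSize hk ha) r)
  by_contra hne
  exact hω ⟨_, outputs_cluster_of_empty hc hne⟩

theorem le_drawLaw_numQueries_le (hk : 2 ≤ k) (ha : 10 ≤ a) (hγ : 0 < γ)
    (hM : maxPacking d γ ≠ ⊤) (hX : 2 ≤ X.card) {s : ℝ} (hs : 0 < s) :
    ENNReal.ofReal (1 - (X.card : ℝ) ^ (-s)) ≤
      drawLaw 𝒳 {ω | (numQueries (mrecover a d γ X ω) c : ℝ≥0∞) ≤
        ENNReal.ofReal ((s + 3) * (a + 1) * packingParam d γ * k * Real.log k *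
          Real.log X.card)} := by
  have hn : (2 : ℝ) ≤ X.card := by exact_mod_cast hX
  have hlogn : Real.log 2 ≤ Real.log X.card := Real.log_le_log two_pos hn
  have h2 := Real.log_two_gt_d9
  -- After `T` rounds, `exp (-T) * n ≤ n ^ (-s)`. Rounding up costs at most `1 ≤ 2 log n`, whence `s
  -- + 3`; the factor `a + 1` absorbs the rounding in the sample size.
  set T := ⌈(s + 1) * Real.log X.card⌉₊
  have hT : (s + 1) * Real.log X.card ≤ T := Nat.le_ceil _
  have hT' : (T : ℝ) ≤ (s + 3) * Real.log X.card := by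
    have := Nat.ceil_lt_add_one (a := (s + 1) * Real.log X.card) (by nlinarith)
    have h3 : (T : ℝ) < (s + 1) * Real.log X.card + 1 := this
    nlinarith
  set A := {ω | (numQueries (mrecover a d γ X ω) c : ℝ≥0∞) ≤
    ENNReal.ofReal ((s + 3) * (a + 1) * packingParam d γ * k * Real.log k * Real.log X.card)}
  have hbad : drawLaw 𝒳 Aᶜ ≤ ENNReal.ofReal ((X.card : ℝ) ^ (-s)) := by
    calc drawLaw 𝒳 Aᶜ ≤ drawLaw 𝒳 {ω | (pool d γ (sampleSize a d γ)
          (transcript (mrecover a d γ X ω) c (T * sampleSize a d γ))).Nonempty} := by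
          refine measure_mono fun ω hω => ?_
          by_contra hne
          refine hω ?_
          have h1 := ENat.toENNReal_le.2 (numQueries_le_of_stopped (mrecover_of_empty hne))
          refine h1.trans ?_
          rw [ENat.toENNReal_coe, ← ENNReal.ofReal_natCast]
          refine ENNReal.ofReal_le_ofReal ?_
          have h3 := sampleSize_le (d := d) (γ := γ) hk (a := a) (by linarith)
          calc ((T * sampleSize a d γ : ℕ) : ℝ) = T * sampleSize a d γ := by push_cast; ring
            _ ≤ ((s + 3) * Real.log X.card) *
                ((a + 1) * (packingParam d γ * k * Real.log k)) := by gcongr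
            _ = _ := by ring
      _ ≤ ENNReal.ofReal (Real.exp (-1)) ^ T * X.card :=
          drawLaw_pool_nonempty_le hγ hM (sampleSize_pos hk (by linarith))
            (packing_le_exp_mul_sampleSize hk ha) T
      _ = ENNReal.ofReal (Real.exp (-1) ^ T * X.card) := by
          rw [ENNReal.ofReal_mul (by positivity), ENNReal.ofReal_pow (Real.exp_pos _).le,
            ENNReal.ofReal_natCast]
      _ ≤ _ := by
          refine ENNReal.ofReal_le_ofReal ?_
          have hpos : (0 : ℝ) < X.card := by linarith
          calc Real.exp (-1) ^ T * X.card
              = Real.exp (-(T : ℝ)) * Real.exp (Real.log X.card) := by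
                rw [← Real.exp_nat_mul, Real.exp_log hpos, mul_neg_one]
            _ ≤ Real.exp (Real.log X.card * -s) := by
                rw [← Real.exp_add]
                exact Real.exp_le_exp.2 (by linarith)
            _ = _ := (Real.rpow_def_of_pos hpos _).symm
  -- Subadditivity suffices, so measurability of `A` is not needed.
  have h1 : 1 ≤ drawLaw 𝒳 A + drawLaw 𝒳 Aᶜ := by
    rw [← measure_univ (μ := drawLaw 𝒳), ← Set.union_compl_self A]
    exact measure_union_le _ _
  rw [ENNReal.ofReal_sub _ (by positivity), ENNReal.ofReal_one, tsub_le_iff_right]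
  exact h1.trans (by gcongr)

end UpperBound

end ClusterRecovery

theorem mainTheorem3 :
    -- Upper bound: MRECOVER with any sufficiently large sample-size constant `a`.
    (∃ a₀ : ℝ, 0 < a₀ ∧ ∀ a : ℝ, a₀ ≤ a →
      -- It never returns anything but the latent clustering, and it stops almost surely.
      (∀ (𝒳 : Type u) (k : ℕ) (d : Fin k → PseudoMetricSpace 𝒳) (γ : ℝ) (X : Finset 𝒳)
          (c : X → Fin k),
        2 ≤ k → 0 < γ → maxPacking d γ ≠ ⊤ → HasMargin d γ c →
          (∀ (ω : Draws 𝒳) (G : Fin k → Finset 𝒳),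
            Outputs (mrecover a d γ X ω) c G → G = cluster c) ∧
          (∀ᵐ ω ∂(drawLaw 𝒳), Outputs (mrecover a d γ X ω) c (cluster c))) ∧
      -- With high probability, it makes `O(M k log k log n)` queries.
      (∀ s : ℝ, 0 < s → ∃ B : ℝ, 0 < B ∧
        ∀ (𝒳 : Type u) (k : ℕ) (d : Fin k → PseudoMetricSpace 𝒳) (γ : ℝ) (X : Finset 𝒳)
          (c : X → Fin k),
          2 ≤ k → 0 < γ → maxPacking d γ ≠ ⊤ → HasMargin d γ c → 2 ≤ X.card →
            ENNReal.ofReal (1 - (X.card : ℝ) ^ (-s)) ≤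
              drawLaw 𝒳 {ω | (numQueries (mrecover a d γ X ω) c : ℝ≥0∞) ≤
                ENNReal.ofReal
                  (B * packingParam d γ * k * Real.log k * Real.log X.card)})) ∧
    -- Lower bound, for randomized algorithms with success probability at least `p`.
    (∀ p : ℝ, 1 / 2 < p → ∃ b : ℝ, 0 < b ∧
      ∀ (𝒳 : Type u) (k : ℕ) (d : Fin k → PseudoMetricSpace 𝒳) (γ : ℝ), 0 < γ →
        -- Some packing of the maximal size `M(2γ)` for one pseudometric is not collapsed by
        -- another one.
        (∃ (i j : Fin k) (z : 𝒳) (r : ℝ) (P : Finset 𝒳), i ≠ j ∧ 0 < r ∧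
          (∀ x ∈ P, (d j).dist x z ≤ r) ∧
          (∀ x ∈ P, ∀ y ∈ P, x ≠ y → 2 * γ * r < (d j).dist x y ∧ 0 < (d i).dist x y) ∧
          (P.card : ℕ∞) = maxPacking d (2 * γ)) →
        ∀ (Ω : Type v) (mΩ : MeasurableSpace Ω) (μ : Measure Ω) (_ : IsProbabilityMeasure μ)
          (A : (X : Finset 𝒳) → Ω → Strategy X k),
          (∀ X hist out, MeasurableSet {ω | A X ω hist = out}) →
          (∀ (X : Finset 𝒳) (c : X → Fin k), HasMargin d γ c →
            ENNReal.ofReal p ≤ μ {ω | Outputs (A X ω) c (cluster c)}) →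
          ∃ (X : Finset 𝒳) (c : X → Fin k), HasMargin d γ c ∧
            ENNReal.ofReal b * (maxPacking d (2 * γ) : ℝ≥0∞) ≤
              ∫⁻ ω, (numQueries (A X ω) c : ℝ≥0∞) ∂μ) := by
  refine ⟨⟨10, by norm_num, fun a ha => ⟨fun 𝒳 k d γ X c hk hγ hM hc =>
    ⟨fun ω G h => eq_cluster_of_outputs hc h, ae_outputs_cluster hk ha hγ hM hc⟩,
    fun s hs => ⟨(s + 3) * (a + 1), by positivity, fun 𝒳 k d γ X c hk hγ hM _ hX =>
      le_drawLaw_numQueries_le hk ha hγ hM hX hs⟩⟩⟩, fun p hp => ⟨2 * p - 1, by linarith, ?_⟩⟩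
  rintro 𝒳 k d γ hγ ⟨i, j, z, r, P, hij, hr, hball, hsep, hP⟩ Ω mΩ μ hμ A hA hcorrect
  refine ⟨P, fun _ => j, hasMargin_const hγ.le hr.le hball, ?_⟩
  rw [← hP, ENat.toENNReal_coe]
  exact le_lintegral_numQueries hp hγ.le hr.le hij hball hsep μ (A P) (hA P) (hcorrect P)
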